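/- Let $X$ be a separable real Banach space with a predual $X_*$ (so $X=(X_*)^*$ isometrically), let $Y$ be a real Hilbert space of finite dimension $Q\in\mathbb N$, and let $A:X\to Y$ be linear and weak*-to-weak continuous, i.e. the adjoint of a bounded linear operator $A_*:Y\to X_*$. Let $S\subset\mathbb R^d$ be non-empty and compact, and let $J:X\times S\to[0,+\infty]$ be Borel measurable and such that * for every $s\in S$, $J(\cdot,s)$ is proper, convex and positively one-homogeneous; * $J$ is sequentially lower semicontinuous on $X\times S$, where $X$ carries the weak* topology; * there is $C>0$ with $\|v\|_X\le C\,J(v,s)$ for all $v\in X$, $s\in S$. Let $\mathcal M_+(S)$ be the set of finite positive Radon measures on $S$. For $v\in X$ and $\sigma\in\mathcal M_+(S)$ put $$R(v,\sigma)=\inf\Big\{\int_S J(u(s),s)\,d\sigma(s)\;:\;u\in L^1((S,\sigma);X),\ \int_S u\,d\sigma=v\Big\}\in[0,+\infty].$$ Let $f\in Y$ and $\alpha>0$, and for $s\in S$ let $B_s=\{v\in X:\alpha J(v,s)\le 1\}$, with set of extremal points $\mathrm{Ext}(B_s)$, and $\mathrm{dom}\,J(\cdot,s)=\{v\in X:J(v,s)<+\infty\}$.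 **Theorem.** Suppose in addition that $J(\lambda v,s)=|\lambda|J(v,s)$ for all $\lambda\in\mathbb R$, $v\in X$, $s\in S$ (with $0\cdot\infty=0$), and that the conical hull (the set of all finite linear combinations with non-negative coefficients) of $\{Av: v\in\bigcup_{s\in S}\mathrm{dom}\,J(\cdot,s)\}$ is all of $Y$. Then there is a pair $(v^*,\sigma^*)\in X\times\mathcal M_+(S)$ that minimizes $$(v,\sigma)\mapsto \tfrac12\|Av-f\|_Y^2+\alpha R(v,\sigma)\qquad\text{over } X\times\mathcal M_+(S)$$ and that has the form $$v^*=\sum_{i=1}^M\lambda_i v_i,\qquad \sigma^*=\sum_{s\in\{s_i\,:\,i=1,\dots,M\}}\Big\|\sum_{j\in\{1,\dots,M\}:\,s_j=s}\lambda_j v_j\Big\|_X\,\delta_s,$$ where $0\le M\le Q$ and, for every $i=1,\dots,M$, $\lambda_i>0$, $s_i\in S$ and $v_i\in\mathrm{Ext}(B_{s_i})\setminus\{0\}$. -/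

import Mathlib

open MeasureTheory Filter Topology
open scoped ENNReal NNReal

noncomputable section

namespace InfConv

/-- Standing assumptions on the family of functionals `J(·, s) : X → [0, ∞]`, `s ∈ S`.
The Banach space `X` is the dual of `P` through the isometric isomorphism `e`, and its weak*
topology is the one it inherits from `WeakDual ℝ P`. In `[0, ∞]` one has `0 * ∞ = 0`. -/
structure IsAdmissible {X P T : Type*}
    [NormedAddCommGroup X] [NormedSpace ℝ X] [MeasurableSpace X]
    [NormedAddCommGroup P] [NormedSpace ℝ P]
    [TopologicalSpace T] [MeasurableSpace T]
    (e : X ≃ₗᵢ[ℝ] StrongDual ℝ P) (J : X → T → ℝ≥0∞) : Prop where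
  measurable : Measurable (Function.uncurry J)
  proper : ∀ s, ∃ v, J v s ≠ ∞
  convex : ∀ s, ConvexOn ℝ≥0 Set.univ (fun v => J v s)
  posHom : ∀ (c : ℝ≥0) (v : X) (s : T), J (c • v) s = c * J v s
  /-- sequential lower semicontinuity for the weak* topology on `X` -/
  lsc : ∀ (v : ℕ → X) (v₀ : X) (s : ℕ → T) (s₀ : T),
    Tendsto (fun n => StrongDual.toWeakDual (e (v n))) atTop
      (𝓝 (StrongDual.toWeakDual (e v₀))) →
    Tendsto s atTop (𝓝 s₀) →
    J v₀ s₀ ≤ liminf (fun n => J (v n) (s n)) atTop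
  coercive : ∃ C : ℝ≥0, 0 < C ∧ ∀ (v : X) (s : T), ‖v‖ₑ ≤ C * J v s

/-- The infinite infimal convolution
`R(v, σ) = inf {∫ J(u(s), s) dσ(s) : u ∈ L¹((S, σ); X), ∫ u dσ = v}` (Bochner integral). -/
def infConv {X T : Type*} [NormedAddCommGroup X] [NormedSpace ℝ X] [MeasurableSpace T]
    (J : X → T → ℝ≥0∞) (v : X) (σ : Measure T) : ℝ≥0∞ :=
  ⨅ (u : T → X) (_ : Integrable u σ) (_ : ∫ s, u s ∂σ = v), ∫⁻ s, J (u s) s ∂σ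

/-- The Tikhonov functional `(v, σ) ↦ ½ ‖A v - f‖² + α R(v, σ)`. -/
def tikhonov {X Y T : Type*} [NormedAddCommGroup X] [NormedSpace ℝ X]
    [NormedAddCommGroup Y] [InnerProductSpace ℝ Y] [MeasurableSpace T]
    (J : X → T → ℝ≥0∞) (A : X →L[ℝ] Y) (f : Y) (α : ℝ) (p : X × FiniteMeasure T) : ℝ≥0∞ :=
  ENNReal.ofReal (1 / 2 * ‖A p.1 - f‖ ^ 2)
    + ENNReal.ofReal α * infConv J p.1 (p.2 : Measure T)

/-- The effective domain `dom J(·, s)`. -/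
def dom {X T : Type*} (J : X → T → ℝ≥0∞) (s : T) : Set X := {v | J v s < ∞}

/-- The unit ball `B_s = {v : α J(v, s) ≤ 1}`. -/
def unitBall {X T : Type*} (J : X → T → ℝ≥0∞) (α : ℝ) (s : T) : Set X :=
  {v | ENNReal.ofReal α * J v s ≤ 1}

end InfConv

end

/-!
Let `D = A (⋃ s, B_s)` and let `K` be the convex hull of `D` in the finite-dimensional space `Y`.

*Reduction.* If `∫ u dσ = v`, then `A v` lies in `r K` with `r = α ∫ J(u(s), s) dσ(s)`: a separating
functional `l` satisfies `l (A w) ≤ (max_K l) α J(w, s)` for all `w` and `s`, and this can be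
integrated (`IsAdmissible.exists_map_integral_eq_smul`). Hence the Tikhonov functional is bounded
below by the minimum of `½ ‖t k - f‖² + t` over `k ∈ K` and `t ≥ 0`, whatever the measure `σ`.

*Compactness.* The graph of `s ↦ B_s` is weak* compact (`IsAdmissible.isCompact_graph_unitBall`), by
the Banach-Alaoglu theorem and the sequential lower semicontinuity of `J`; sequences suffice because
the predual of a separable space is separable (`separableSpace_of_strongDual`). So `D` and `K` are
compact, and the reduced problem has a solution `(k, t)`.

*Sparsity.* By Minkowski's theorem (`subset_convexHull_extremePoints`), `k` is a convex combination
of extremal points of `K`. These lie in `D`, and each is the image of an extremal point of some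
`B_s` (`IsAdmissible.exists_mem_extremePoints_unitBall`). Subtracting linear relations
(`exists_linearIndepOn_sum_smul_eq`) gives `t k = ∑ c_i A v_i` with total weight at most `t` and
with linearly independent `A v_i`. There are then at most `dim Y` of them, and no `v_i` vanishes.

*Attainment.* For `v* = ∑ c_i v_i` and the associated measure `σ*`, the density
`u(s) = w_s / ‖w_s‖` with `w_s = ∑_{s_j = s} c_j v_j` has cost at most `∑ c_i ≤ t`, by homogeneity
and subadditivity of `J` (`IsAdmissible.infConv_sum_dirac_le`), so the lower bound is attained.
-/

namespace InfConv

/-! ### Convexity in finite dimension -/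

/-- The inductive step of Minkowski's theorem: either `x` already lies in the convex hull of the
extreme points, or a nonzero functional is maximized over `K` at `x`. -/
theorem mem_convexHull_extremePoints_or_exists_le {E : Type*} [NormedAddCommGroup E]
    [NormedSpace ℝ E] [FiniteDimensional ℝ E] {K : Set E} (hK : IsCompact K) (hc : Convex ℝ K)
    {x : E} (hx : x ∈ K) :
    x ∈ convexHull ℝ (K.extremePoints ℝ) ∨ ∃ l : StrongDual ℝ E, l ≠ 0 ∧ ∀ y ∈ K, l y ≤ l x := by
  set C := convexHull ℝ (K.extremePoints ℝ) with hC
  have hCc : Convex ℝ C := convex_convexHull _ _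
  have hcl : closure C = K := closure_convexHull_extremePoints hK hc
  have hCne : C.Nonempty := closure_nonempty_iff.1 (hcl ▸ ⟨x, hx⟩)
  by_cases hint : (interior C).Nonempty
  · by_cases hxi : x ∈ interior C
    · exact Or.inl (interior_subset hxi)
    right
    obtain ⟨l, hl⟩ := geometric_hahn_banach_open_point hCc.interior isOpen_interior hxi
    refine ⟨l, ?_, fun y hy => ?_⟩
    · rintro rfl
      obtain ⟨y, hy⟩ := hint
      simpa using hl y hy
    · have hy' : y ∈ closure (interior C) := by
        rw [hCc.closure_interior_eq_closure_of_nonempty_interior hint, hcl]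
        exact hy
      exact closure_minimal (fun z hz => (hl z hz).le)
        (isClosed_le l.continuous continuous_const) hy'
  · right
    -- `C` has empty interior, so it lies in a hyperplane, and so does its closure `K`
    rw [hCc.interior_nonempty_iff_affineSpan_eq_top,
      ← AffineSubspace.direction_eq_top_iff_of_nonempty
        ((affineSpan_nonempty ℝ).2 hCne)] at hint
    obtain ⟨φ, hφ0, hφ⟩ := Submodule.exists_le_ker_of_lt_top _ (lt_top_iff_ne_top.2 hint)
    obtain ⟨z, hz⟩ := hCne
    have hconst : ∀ y ∈ K, LinearMap.toContinuousLinearMap φ y = φ z := by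
      rw [← hcl]
      refine fun y hy => closure_minimal (t := {y | LinearMap.toContinuousLinearMap φ y = φ z})
        (fun w hw => ?_) (isClosed_eq (LinearMap.toContinuousLinearMap φ).continuous
          continuous_const) hy
      have := hφ (AffineSubspace.vsub_mem_direction (subset_affineSpan ℝ C hw)
        (subset_affineSpan ℝ C hz))
      rw [LinearMap.mem_ker, vsub_eq_sub, map_sub, sub_eq_zero] at this
      exact this
    refine ⟨LinearMap.toContinuousLinearMap φ, fun h => hφ0 ?_, fun y hy => ?_⟩
    · ext y
      exact DFunLike.congr_fun h y
    · rw [hconst y hy, hconst x hx]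

/-- **Minkowski's theorem**: in finite dimension, the closure is not needed in the Krein-Milman
theorem. The induction passes to the face of `K` cut out by a supporting hyperplane at the point. -/
theorem subset_convexHull_extremePoints {E : Type*} [NormedAddCommGroup E]
    [NormedSpace ℝ E] [FiniteDimensional ℝ E] {K : Set E} (hK : IsCompact K) (hc : Convex ℝ K) :
    K ⊆ convexHull ℝ (K.extremePoints ℝ) := by
  induction hn : Module.finrank ℝ E using Nat.strong_induction_on generalizing E with
  | _ n ih =>
  intro x hx
  rcases mem_convexHull_extremePoints_or_exists_le hK hc hx with h | ⟨l, hl0, hl⟩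
  · exact h
  -- The face `{y ∈ K | l y = l x}`, translated by `-x`, is a subset of `ker l`.
  let H : Submodule ℝ E := LinearMap.ker (l : E →ₗ[ℝ] ℝ)
  have hH : H < ⊤ := by
    refine lt_top_iff_ne_top.2 fun h => hl0 ?_
    ext y
    have : y ∈ H := h ▸ Submodule.mem_top
    exact this
  have hfr : Module.finrank ℝ H < n := hn ▸ Submodule.finrank_lt hH.ne
  let g : H →ᵃ[ℝ] E := H.subtype.toAffineMap + AffineMap.const ℝ H x
  have hg : ∀ w : H, g w = w + x := fun w => rfl
  have hgc : IsClosedEmbedding g :=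
    (Homeomorph.addRight x).isClosedEmbedding.comp
      (Submodule.closed_of_finiteDimensional H).isClosedEmbedding_subtypeVal
  have key := ih _ hfr (hgc.isCompact_preimage hK) (hc.affine_preimage g) rfl
    (show (0 : H) ∈ g ⁻¹' K by simpa [hg] using hx)
  have hmem : x ∈ g '' convexHull ℝ ((g ⁻¹' K).extremePoints ℝ) := ⟨0, key, by simp [hg]⟩
  rw [AffineMap.image_convexHull] at hmem
  refine convexHull_mono ?_ hmem
  rintro _ ⟨w, hw, rfl⟩
  refine ⟨hw.1, fun y hy z hz hyz => ?_⟩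
  obtain ⟨a, b, ha, hb, hab, heq⟩ := hyz
  have hlw : l (w : E) = 0 := w.2
  have h1 : a * l y + b * l z = l x := by
    have := congrArg l heq
    simpa [hg, hlw] using this
  -- A point of `K` at which `l` is maximal lies between `y` and `z`, so `l` is maximal at both.
  have hly : l y = l x := by
    refine le_antisymm (hl y hy) ?_
    have := hl z hz
    have hb' : b = 1 - a := by linarith
    subst hb'
    nlinarith
  have hlz : l z = l x := by
    refine le_antisymm (hl z hz) ?_
    have hb' : b = 1 - a := by linarith
    subst hb'
    rw [hly] at h1
    nlinarith
  let y' : H := ⟨y - x, by simp [H, hly]⟩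
  let z' : H := ⟨z - x, by simp [H, hlz]⟩
  have hy' : g y' = y := by simp [hg, y']
  have hz' : g z' = z := by simp [hg, z']
  have hseg : w ∈ openSegment ℝ y' z' := by
    refine ⟨a, b, ha, hb, hab, hgc.injective ?_⟩
    rw [← heq, ← hy', ← hz']
    simp only [hg, Submodule.coe_add, Submodule.coe_smul, smul_add]
    rw [add_add_add_comm, ← add_smul, hab, one_smul]
  have := hw.2 (x₁ := y') (by simpa [hy'] using hy) (x₂ := z') (by simpa [hz'] using hz) hseg
  rw [← this, hy']

/-- By Carathéodory's theorem, the convex hull of a compact set is the image of a compact set of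
weights and points. -/
theorem isCompact_convexHull {E : Type*} [NormedAddCommGroup E]
    [NormedSpace ℝ E] [FiniteDimensional ℝ E] {D : Set E} (hD : IsCompact D) :
    IsCompact (convexHull ℝ D) := by
  rcases D.eq_empty_or_nonempty with rfl | ⟨p, hp⟩
  · simp
  let ι := Fin (Module.finrank ℝ E + 1)
  have hcomp : IsCompact ((fun q : (ι → ℝ) × (ι → E) => ∑ i, q.1 i • q.2 i) ''
      (stdSimplex ℝ ι ×ˢ Set.univ.pi fun _ => D)) := by
    refine IsCompact.image ((isCompact_stdSimplex ℝ ι).prod (isCompact_univ_pi fun _ => hD)) ?_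
    fun_prop
  convert hcomp
  refine Set.Subset.antisymm (fun x hx => ?_) ?_
  · obtain ⟨κ, _, z, w, hz, hind, hw, hw1, rfl⟩ := eq_pos_convex_span_of_mem_convexHull hx
    have hcard : Fintype.card κ ≤ Fintype.card ι := by
      refine hind.card_le_finrank_succ.trans ?_
      simpa [ι] using Submodule.finrank_le _
    obtain ⟨φ⟩ := Function.Embedding.nonempty_of_card_le hcard
    refine ⟨(Function.extend φ w 0, Function.extend φ z fun _ => p), ⟨⟨fun i => ?_, ?_⟩,
      fun i _ => ?_⟩, ?_⟩
    · by_cases hi : ∃ j, φ j = i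
      · obtain ⟨j, rfl⟩ := hi
        simpa [φ.injective.extend_apply] using (hw j).le
      · simp [Function.extend_apply' _ _ _ hi]
    · rw [← hw1]
      refine (Fintype.sum_of_injective φ φ.injective _ _ (fun i hi => ?_) fun j => ?_).symm
      · exact Function.extend_apply' _ _ _ hi
      · simp [φ.injective.extend_apply]
    · by_cases hi : ∃ j, φ j = i
      · obtain ⟨j, rfl⟩ := hi
        simpa [φ.injective.extend_apply] using hz ⟨j, rfl⟩
      · simpa [Function.extend_apply' _ _ _ hi] using hp
    · refine (Fintype.sum_of_injective φ φ.injective _ _ (fun i hi => ?_) fun j => ?_).symm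
      · simp [Function.extend_apply' _ _ _ hi]
      · simp [φ.injective.extend_apply]
  · rintro _ ⟨⟨w, z⟩, ⟨hw, hz⟩, rfl⟩
    exact (convex_convexHull ℝ D).sum_mem (fun i _ => hw.1 i) hw.2
      fun i _ => subset_convexHull ℝ D (hz i trivial)

/-- Carathéodory's theorem for cones, keeping track of the total weight: a linear relation with
non-negative coefficient sum can be subtracted until a weight vanishes. -/
theorem exists_linearIndepOn_sum_smul_eq {E ι : Type*} [AddCommGroup E] [Module ℝ E]
    (z : ι → E) (s : Finset ι) (c : ι → ℝ) (hc : ∀ i ∈ s, 0 ≤ c i) :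
    ∃ t ⊆ s, ∃ b : ι → ℝ, (∀ i ∈ t, 0 < b i) ∧ ∑ i ∈ t, b i • z i = ∑ i ∈ s, c i • z i ∧
      ∑ i ∈ t, b i ≤ ∑ i ∈ s, c i ∧ LinearIndepOn ℝ z (t : Set ι) := by
  classical
  induction s using Finset.strongInduction generalizing c with
  | H s ih =>
  have remove : ∀ c' : ι → ℝ, (∀ i ∈ s, 0 ≤ c' i) → (∃ i ∈ s, c' i = 0) →
      ∑ i ∈ s, c' i • z i = ∑ i ∈ s, c i • z i → ∑ i ∈ s, c' i ≤ ∑ i ∈ s, c i →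
      ∃ t ⊆ s, ∃ b : ι → ℝ, (∀ i ∈ t, 0 < b i) ∧ ∑ i ∈ t, b i • z i = ∑ i ∈ s, c i • z i ∧
      ∑ i ∈ t, b i ≤ ∑ i ∈ s, c i ∧ LinearIndepOn ℝ z (t : Set ι) := by
    rintro c' hc' ⟨i₀, hi₀, h0⟩ hz hle
    obtain ⟨t, hts, b, hb, hbz, hble, hli⟩ := ih _ (Finset.erase_ssubset hi₀) c'
      fun i hi => hc' i (Finset.mem_of_mem_erase hi)
    refine ⟨t, hts.trans (Finset.erase_subset _ _), b, hb, ?_, ?_, hli⟩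
    · rw [hbz, ← hz]
      exact Finset.sum_erase _ (by simp [h0])
    · refine hble.trans (le_trans (le_of_eq ?_) hle)
      exact Finset.sum_erase _ h0
  by_cases hzero : ∃ i ∈ s, c i = 0
  · exact remove c hc hzero rfl le_rfl
  push Not at hzero
  have hpos : ∀ i ∈ s, 0 < c i := fun i hi => lt_of_le_of_ne (hc i hi) (hzero i hi).symm
  by_cases hli : LinearIndepOn ℝ z (s : Set ι)
  · exact ⟨s, subset_rfl, c, hpos, rfl, le_rfl, hli⟩
  have hrel : ∃ g : ι → ℝ, ∑ i ∈ s, g i • z i = 0 ∧ (∃ i ∈ s, g i ≠ 0) ∧ 0 ≤ ∑ i ∈ s, g i := by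
    obtain ⟨g, hg, hne⟩ := not_linearIndepOn_finset_iff.1 hli
    rcases le_total 0 (∑ i ∈ s, g i) with h | h
    · exact ⟨g, hg, hne, h⟩
    · exact ⟨-g, by simpa using hg, by simpa using hne, by simpa using h⟩
  obtain ⟨g, hg, ⟨i₁, hi₁, hne⟩, hsum⟩ := hrel
  have hex : (s.filter fun i => 0 < g i).Nonempty := by
    by_contra hcon
    rw [Finset.not_nonempty_iff_eq_empty, Finset.filter_eq_empty_iff] at hcon
    push Not at hcon
    have h0 : ∑ i ∈ s, g i = 0 := le_antisymm (Finset.sum_nonpos hcon) hsum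
    exact hne ((Finset.sum_eq_zero_iff_of_nonpos hcon).1 h0 i₁ hi₁)
  -- The largest multiple of the relation that keeps all weights non-negative.
  obtain ⟨i₀, hi₀, hmin⟩ := Finset.exists_min_image _ (fun i => c i / g i) hex
  rw [Finset.mem_filter] at hi₀
  have hθ : 0 ≤ c i₀ / g i₀ := div_nonneg (hc _ hi₀.1) hi₀.2.le
  refine remove (fun i => c i - c i₀ / g i₀ * g i) (fun i hi => ?_) ⟨i₀, hi₀.1, ?_⟩ ?_ ?_
  · rcases lt_or_ge 0 (g i) with h | h
    · have := hmin i (Finset.mem_filter.2 ⟨hi, h⟩)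
      rw [le_div_iff₀ h] at this
      linarith
    · have := mul_nonpos_of_nonneg_of_nonpos hθ h
      have := hc i hi
      linarith
  · rw [div_mul_cancel₀ _ hi₀.2.ne', sub_self]
  · simp only [sub_smul, mul_smul, Finset.sum_sub_distrib, ← Finset.smul_sum, hg, smul_zero,
      sub_zero]
  · rw [Finset.sum_sub_distrib, ← Finset.mul_sum]
    have := mul_nonneg hθ hsum
    linarith

/-! ### Separability of a predual -/

/-- A normed space with separable dual is separable: points at which the members of a dense
sequence of functionals almost attain their norms span a dense subspace. -/
theorem separableSpace_of_strongDual {P : Type*} [NormedAddCommGroup P] [NormedSpace ℝ P]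
    [TopologicalSpace.SeparableSpace (StrongDual ℝ P)] : TopologicalSpace.SeparableSpace P := by
  have hex : ∀ x : StrongDual ℝ P, ∃ p : P, ‖p‖ ≤ 1 ∧ ‖x‖ / 2 ≤ ‖x p‖ := by
    intro x
    rcases eq_or_ne x 0 with rfl | hx
    · exact ⟨0, by simp⟩
    · obtain ⟨p, hp, hxp⟩ := x.exists_lt_apply_of_lt_opNorm (half_lt_self (norm_pos_iff.2 hx))
      exact ⟨p, hp.le, hxp.le⟩
  choose p hp hxp using hex
  let q : ℕ → P := fun n => p (TopologicalSpace.denseSeq (StrongDual ℝ P) n)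
  let W : Submodule ℝ P := (Submodule.span ℝ (Set.range q)).topologicalClosure
  have hW : (W : Set P) = Set.univ := by
    by_contra hne
    obtain ⟨y, hy⟩ := (Set.ne_univ_iff_exists_notMem _).1 hne
    obtain ⟨l, u, hl, hly⟩ := geometric_hahn_banach_closed_point W.convex
      (Submodule.isClosed_topologicalClosure _) hy
    -- A functional bounded above on a subspace vanishes on it.
    have hl0 : ∀ w ∈ W, l w = 0 := by
      intro w hw
      by_contra hlw
      have h1 := hl _ (W.smul_mem (u / l w) hw)
      rw [map_smul, smul_eq_mul, div_mul_cancel₀ _ hlw] at h1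
      exact lt_irrefl _ h1
    have hlne : 0 < ‖l‖ := by
      rw [norm_pos_iff]
      rintro rfl
      have := hl 0 W.zero_mem
      simp only [zero_apply] at this hly
      exact lt_asymm this hly
    obtain ⟨n, hn⟩ := (TopologicalSpace.denseRange_denseSeq (StrongDual ℝ P)).exists_dist_lt l
      (show 0 < ‖l‖ / 4 by positivity)
    set x := TopologicalSpace.denseSeq (StrongDual ℝ P) n with hx
    have hq : l (p x) = 0 := hl0 _
      (Submodule.le_topologicalClosure _ (Submodule.subset_span ⟨n, rfl⟩))
    have h2 : ‖x (p x)‖ ≤ ‖l - x‖ := by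
      have : ‖(l - x) (p x)‖ ≤ ‖l - x‖ * ‖p x‖ := (l - x).le_opNorm _
      rw [sub_apply, hq, zero_sub, norm_neg] at this
      exact this.trans (mul_le_of_le_one_right (norm_nonneg _) (hp x))
    have h3 := hxp x
    have h4 : ‖l‖ ≤ ‖l - x‖ + ‖x‖ := by simpa using norm_add_le (l - x) x
    rw [dist_eq_norm] at hn
    linarith
  rw [← TopologicalSpace.isSeparable_univ_iff, ← hW]
  exact ((Set.countable_range q).isSeparable.span (R := ℝ)).closure

/-! ### The functionals `J(·, s)` and their unit balls -/

section

variable {X P T : Type*}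
    [NormedAddCommGroup X] [NormedSpace ℝ X] [MeasurableSpace X]
    [NormedAddCommGroup P] [NormedSpace ℝ P]
    [TopologicalSpace T] [MeasurableSpace T]
    {e : X ≃ₗᵢ[ℝ] StrongDual ℝ P} {J : X → T → ℝ≥0∞}

theorem IsAdmissible.apply_zero (hJ : IsAdmissible e J) (s : T) : J 0 s = 0 := by
  simpa using hJ.posHom 0 0 s

theorem IsAdmissible.eq_zero_of_apply_eq_zero (hJ : IsAdmissible e J) {v : X} {s : T}
    (h : J v s = 0) : v = 0 := by
  obtain ⟨C, -, hC⟩ := hJ.coercive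
  simpa [h] using hC v s

theorem IsAdmissible.apply_smul (hJ : IsAdmissible e J) {c : ℝ} (hc : 0 ≤ c) (v : X) (s : T) :
    J (c • v) s = ENNReal.ofReal c * J v s := by
  lift c to ℝ≥0 using hc
  rw [ENNReal.ofReal_coe_nnreal]
  exact hJ.posHom c v s

/-- A convex positively homogeneous functional is subadditive. -/
theorem IsAdmissible.apply_add_le (hJ : IsAdmissible e J) (v w : X) (s : T) :
    J (v + w) s ≤ J v s + J w s := by
  have h2 : (2⁻¹ : ℝ≥0) + 2⁻¹ = 1 := by
    rw [← two_mul]; exact mul_inv_cancel₀ two_ne_zero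
  have h := (hJ.convex s).2 (Set.mem_univ v) (Set.mem_univ w) (zero_le : (0 : ℝ≥0) ≤ 2⁻¹)
    zero_le h2
  simp only [← smul_add] at h
  rw [hJ.posHom, ENNReal.smul_def, smul_eq_mul] at h
  have hne : ((2⁻¹ : ℝ≥0) : ℝ≥0∞) ≠ 0 := by simp
  exact (ENNReal.mul_le_mul_iff_right hne ENNReal.coe_ne_top).1 h

theorem IsAdmissible.apply_sum_smul_le (hJ : IsAdmissible e J) {ι : Type*} (t : Finset ι)
    {c : ι → ℝ} (hc : ∀ i ∈ t, 0 ≤ c i) (v : ι → X) (s : T) :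
    J (∑ i ∈ t, c i • v i) s ≤ ∑ i ∈ t, ENNReal.ofReal (c i) * J (v i) s := by
  refine (Finset.le_sum_of_subadditive (fun x => J x s) (hJ.apply_zero s).le
    (fun x y => hJ.apply_add_le x y s) t fun i => c i • v i).trans ?_
  exact Finset.sum_le_sum fun i hi => (hJ.apply_smul (hc i hi) _ _).le

theorem IsAdmissible.zero_mem_unitBall (hJ : IsAdmissible e J) (α : ℝ) (s : T) :
    (0 : X) ∈ unitBall J α s := by
  simp [unitBall, hJ.apply_zero s]

theorem IsAdmissible.exists_norm_le_of_mem_unitBall (hJ : IsAdmissible e J) {α : ℝ} (hα : 0 < α) :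
    ∃ r : ℝ, ∀ (s : T), ∀ v ∈ unitBall J α s, ‖v‖ ≤ r := by
  obtain ⟨C, -, hC⟩ := hJ.coercive
  refine ⟨C / α, fun s v hv => ?_⟩
  have hv' : ENNReal.ofReal α * J v s ≤ 1 := hv
  have h : ENNReal.ofReal (α * ‖v‖) ≤ ENNReal.ofReal C := by
    rw [ENNReal.ofReal_mul hα.le, ofReal_norm, ENNReal.ofReal_coe_nnreal]
    calc ENNReal.ofReal α * ‖v‖ₑ ≤ ENNReal.ofReal α * (C * J v s) := by gcongr; exact hC v s
      _ = C * (ENNReal.ofReal α * J v s) := by ring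
      _ ≤ C * 1 := by gcongr
      _ = C := mul_one _
  have h := (ENNReal.ofReal_le_ofReal_iff C.2).1 h
  rw [NNReal.val_eq_coe] at h
  rw [le_div_iff₀ hα]
  linarith

end

/-! ### Weak* compactness of the unit balls -/

section

variable {X P T : Type*}
    [NormedAddCommGroup X] [NormedSpace ℝ X]
    [NormedAddCommGroup P] [NormedSpace ℝ P]

/-- The isomorphism `e` of `X` with the dual of `P`, with values in the weak* dual. -/
noncomputable abbrev toWeakDual (e : X ≃ₗᵢ[ℝ] StrongDual ℝ P) : X ≃ₗ[ℝ] WeakDual ℝ P :=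
  e.toLinearEquiv.trans StrongDual.toWeakDual

/-- The graph of `s ↦ B_s` is compact for the product of the weak* topology with the topology of
the compact parameter space. It is sequentially closed by lower semicontinuity of `J`, and it lies
over a weak* compact ball, which is metrizable because `P` is separable. -/
theorem IsAdmissible.isCompact_graph_unitBall [MeasurableSpace X]
    [TopologicalSpace T] [MeasurableSpace T] [CompactSpace T]
    [TopologicalSpace.MetrizableSpace T] [TopologicalSpace.SeparableSpace P]
    {e : X ≃ₗᵢ[ℝ] StrongDual ℝ P} {J : X → T → ℝ≥0∞}
    (hJ : IsAdmissible e J) {α : ℝ} (hα : 0 < α) :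
    IsCompact {q : WeakDual ℝ P × T | (toWeakDual e).symm q.1 ∈ unitBall J α q.2} := by
  obtain ⟨r, hr⟩ := hJ.exists_norm_le_of_mem_unitBall hα
  let K : Set (WeakDual ℝ P) := WeakDual.toStrongDual ⁻¹' Metric.closedBall 0 r
  have hK : IsCompact K := WeakDual.isCompact_closedBall _ _
  have : CompactSpace K := isCompact_iff_compactSpace.1 hK
  have : TopologicalSpace.MetrizableSpace K := WeakDual.metrizable_of_isCompact ℝ P K hK
  have hcl : IsClosed {q : K × T |
      (toWeakDual e).symm (q.1 : WeakDual ℝ P) ∈ unitBall J α q.2} := by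
    rw [← isSeqClosed_iff_isClosed]
    intro q q₀ hq hlim
    have h1 : Tendsto (fun n => ((q n).1 : WeakDual ℝ P)) atTop (𝓝 (q₀.1 : WeakDual ℝ P)) :=
      ((continuous_subtype_val.comp continuous_fst).tendsto q₀).comp hlim
    have h2 : Tendsto (fun n => (q n).2) atTop (𝓝 q₀.2) := (continuous_snd.tendsto q₀).comp hlim
    have hl := hJ.lsc (fun n => (toWeakDual e).symm ((q n).1 : WeakDual ℝ P))
      ((toWeakDual e).symm (q₀.1 : WeakDual ℝ P)) (fun n => (q n).2) q₀.2
      (by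
        have hid : ∀ x : WeakDual ℝ P,
          StrongDual.toWeakDual (e ((toWeakDual e).symm x)) = x := (toWeakDual e).apply_symm_apply
        simpa only [hid] using h1) h2
    have hα' : ENNReal.ofReal α ≠ 0 := by simpa using hα
    have hbd : ∀ (v : X) (s : T), v ∈ unitBall J α s ↔ J v s ≤ (ENNReal.ofReal α)⁻¹ := by
      intro v s
      rw [ENNReal.le_inv_iff_mul_le, mul_comm]
      rfl
    refine (hbd _ _).2 (hl.trans ?_)
    refine liminf_le_of_le (by isBoundedDefault) fun b hb => ?_
    obtain ⟨n, hn⟩ := hb.exists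
    exact hn.trans ((hbd _ _).1 (hq n))
  convert hcl.isCompact.image
    (show Continuous fun q : K × T => ((q.1 : WeakDual ℝ P), q.2) by fun_prop) using 1
  ext ⟨x, s⟩
  constructor
  · intro h
    refine ⟨(⟨x, ?_⟩, s), h, rfl⟩
    have := hr s _ h
    rw [Set.mem_preimage, mem_closedBall_zero_iff]
    simpa using this
  · rintro ⟨⟨k, t⟩, h, heq⟩
    cases heq
    exact h

/-- An operator with finite-dimensional range and a preadjoint is weak* continuous. -/
theorem continuous_comp_symm_toWeakDual {Y : Type*} [NormedAddCommGroup Y] [InnerProductSpace ℝ Y]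
    [FiniteDimensional ℝ Y] (e : X ≃ₗᵢ[ℝ] StrongDual ℝ P) (A : X →L[ℝ] Y)
    (hA : ∃ Apre : Y →L[ℝ] P, ∀ (x : X) (y : Y), inner ℝ (A x) y = e x (Apre y)) :
    Continuous fun x : WeakDual ℝ P => A ((toWeakDual e).symm x) := by
  obtain ⟨Apre, hApre⟩ := hA
  let b := stdOrthonormalBasis ℝ Y
  have h : (fun x : WeakDual ℝ P => A ((toWeakDual e).symm x)) =
      fun x => ∑ i, x (Apre (b i)) • b i := by
    ext x
    rw [← b.sum_repr' (A _)]
    refine Finset.sum_congr rfl fun i _ => ?_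
    rw [real_inner_comm, hApre]
    have : e ((toWeakDual e).symm x) = WeakDual.toStrongDual x := e.apply_symm_apply _
    rw [this]
    rfl
  rw [h]
  exact continuous_finsetSum _ fun i _ => (WeakDual.eval_continuous _).smul continuous_const

variable {Y : Type*} [NormedAddCommGroup Y] [InnerProductSpace ℝ Y] [FiniteDimensional ℝ Y]
  [MeasurableSpace X] [TopologicalSpace T] [MeasurableSpace T] [CompactSpace T]
  [TopologicalSpace.MetrizableSpace T] [TopologicalSpace.SeparableSpace P]
  {e : X ≃ₗᵢ[ℝ] StrongDual ℝ P} {J : X → T → ℝ≥0∞}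

theorem IsAdmissible.isCompact_image_iUnion_unitBall (hJ : IsAdmissible e J) {α : ℝ} (hα : 0 < α)
    (A : X →L[ℝ] Y)
    (hA : ∃ Apre : Y →L[ℝ] P, ∀ (x : X) (y : Y), inner ℝ (A x) y = e x (Apre y)) :
    IsCompact (A '' ⋃ s, unitBall J α s) := by
  convert (hJ.isCompact_graph_unitBall hα).image
    ((continuous_comp_symm_toWeakDual e A hA).comp continuous_fst) using 1
  ext y
  constructor
  · rintro ⟨v, hv, rfl⟩
    obtain ⟨s, hs⟩ := Set.mem_iUnion.1 hv
    exact ⟨(toWeakDual e v, s), by simpa using hs, by simp⟩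
  · rintro ⟨⟨x, s⟩, h, rfl⟩
    exact ⟨(toWeakDual e).symm x, Set.mem_iUnion.2 ⟨s, h⟩, rfl⟩

/-- Extremal points of the image `A B_s` lift to extremal points of `B_s`, by the Krein-Milman
theorem on the weak* compact fibres. -/
theorem IsAdmissible.exists_mem_extremePoints_unitBall (hJ : IsAdmissible e J) {α : ℝ} (hα : 0 < α)
    (A : X →L[ℝ] Y)
    (hA : ∃ Apre : Y →L[ℝ] P, ∀ (x : X) (y : Y), inner ℝ (A x) y = e x (Apre y)) {s : T} {z : Y}
    (hz : z ∈ (A '' unitBall J α s).extremePoints ℝ) :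
    ∃ v ∈ (unitBall J α s).extremePoints ℝ, A v = z := by
  have hcomp : IsCompact (toWeakDual e '' unitBall J α s) := by
    convert (((hJ.isCompact_graph_unitBall hα).inter_right
      (isClosed_singleton.preimage continuous_snd : IsClosed (Prod.snd ⁻¹' {s}))).image
        continuous_fst) using 1
    ext x
    constructor
    · rintro ⟨v, hv, rfl⟩
      exact ⟨(toWeakDual e v, s), ⟨by simpa using hv, rfl⟩, rfl⟩
    · rintro ⟨⟨x, t⟩, ⟨h, rfl⟩, rfl⟩
      exact ⟨_, h, (toWeakDual e).apply_symm_apply x⟩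
  let B : WeakDual ℝ P →L[ℝ] Y :=
    ⟨(A : X →ₗ[ℝ] Y) ∘ₗ (toWeakDual e).symm.toLinearMap, continuous_comp_symm_toWeakDual e A hA⟩
  have hB : ∀ v, B (toWeakDual e v) = A v := fun v => by
    change A ((toWeakDual e).symm (toWeakDual e v)) = A v
    rw [LinearEquiv.symm_apply_apply]
  have himage : B.toContinuousAffineMap '' (toWeakDual e '' unitBall J α s) =
      A '' unitBall J α s := by
    rw [Set.image_image]
    exact Set.image_congr fun v _ => hB v
  rw [← himage] at hz
  have : LocallyConvexSpace ℝ (WeakDual ℝ P) := WeakBilin.locallyConvexSpace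
  obtain ⟨x, hx, hxz⟩ := surjOn_extremePoints_image B.toContinuousAffineMap hcomp hz
  rw [← image_extremePoints] at hx
  obtain ⟨v, hv, rfl⟩ := hx
  exact ⟨v, hv, (hB v).symm.trans hxz⟩

end

/-! ### Bounds for the infimal convolution -/

section

variable {X P T Y : Type*}
    [NormedAddCommGroup X] [NormedSpace ℝ X] [MeasurableSpace X]
    [NormedAddCommGroup P] [NormedSpace ℝ P]
    [TopologicalSpace T] [MeasurableSpace T]
    {e : X ≃ₗᵢ[ℝ] StrongDual ℝ P} {J : X → T → ℝ≥0∞}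

/-- A functional bounded by `h` on the unit ball `B_s` is bounded by the multiple `h (α J(·, s))` of
the gauge of that ball. -/
theorem IsAdmissible.apply_le_of_unitBall (hJ : IsAdmissible e J) {α : ℝ} (hα : 0 < α)
    (l : X →L[ℝ] ℝ) {h : ℝ} {s : T} (hl : ∀ v ∈ unitBall J α s, l v ≤ h)
    {v : X} (hv : J v s ≠ ∞) : l v ≤ h * (α * (J v s).toReal) := by
  rcases eq_or_ne (J v s) 0 with h0 | h0
  · simp [hJ.eq_zero_of_apply_eq_zero h0, hJ.apply_zero]
  have hj : 0 < α * (J v s).toReal := mul_pos hα (ENNReal.toReal_pos h0 hv)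
  have hmem : (α * (J v s).toReal)⁻¹ • v ∈ unitBall J α s := by
    change ENNReal.ofReal α * J _ s ≤ 1
    rw [hJ.apply_smul (inv_nonneg.2 hj.le)]
    nth_rewrite 2 [← ENNReal.ofReal_toReal hv]
    rw [← ENNReal.ofReal_mul (inv_nonneg.2 hj.le), ← ENNReal.ofReal_mul hα.le,
      ENNReal.ofReal_le_one]
    exact (inv_mul_cancel₀ hj.ne' ▸ le_of_eq (by ring))
  have := hl _ hmem
  rw [map_smul, smul_eq_mul, inv_mul_le_iff₀ hj] at this
  linarith

/-- If `u` has finite cost `r = α ∫ J(u(s), s) dσ(s)`, then `A ∫ u dσ` lies in `r K`, where `K` is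
the convex hull of the images of the unit balls. Otherwise a hyperplane separates the point from
`r K`, and integrating the separating functional gives a contradiction. -/
theorem IsAdmissible.exists_map_integral_eq_smul [CompleteSpace X] [BorelSpace X]
    [NormedAddCommGroup Y] [NormedSpace ℝ Y]
    [CompleteSpace Y] [Nonempty T] (hJ : IsAdmissible e J) {α : ℝ} (hα : 0 < α)
    (A : X →L[ℝ] Y) (hK : IsCompact (convexHull ℝ (A '' ⋃ s, unitBall J α s)))
    {σ : Measure T} {u : T → X} (hu : Integrable u σ) (hfin : ∫⁻ s, J (u s) s ∂σ ≠ ∞) :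
    ∃ k ∈ convexHull ℝ (A '' ⋃ s, unitBall J α s),
      A (∫ s, u s ∂σ) = (α * (∫⁻ s, J (u s) s ∂σ).toReal) • k := by
  set K := convexHull ℝ (A '' ⋃ s, unitBall J α s) with hKdef
  set r := α * (∫⁻ s, J (u s) s ∂σ).toReal with hr
  have hsub : ∀ s, ∀ v ∈ unitBall J α s, A v ∈ K := fun s v hv =>
    subset_convexHull ℝ _ ⟨v, Set.mem_iUnion.2 ⟨s, hv⟩, rfl⟩
  have h0K : (0 : Y) ∈ K := by
    simpa using hsub (Classical.arbitrary T) 0 (hJ.zero_mem_unitBall α _)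
  suffices h : A (∫ s, u s ∂σ) ∈ (fun k : Y => r • k) '' K by
    obtain ⟨k, hk, hk'⟩ := h
    exact ⟨k, hk, hk'.symm⟩
  by_contra hcon
  have hcomp : IsCompact ((fun k : Y => r • k) '' K) := hK.image (continuous_const_smul r)
  have hconv : Convex ℝ ((fun k : Y => r • k) '' K) := (convex_convexHull ℝ _).smul r
  obtain ⟨l, a, hla, hal⟩ := geometric_hahn_banach_closed_point hconv hcomp.isClosed hcon
  obtain ⟨k₀, hk₀, hmax⟩ := hK.exists_isMaxOn ⟨0, h0K⟩ l.continuous.continuousOn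
  have hk₀' := hla _ ⟨k₀, hk₀, rfl⟩
  simp only [map_smul, smul_eq_mul] at hk₀'
  have hJm : AEMeasurable (fun s => J (u s) s) σ :=
    hJ.measurable.comp_aemeasurable (hu.aestronglyMeasurable.aemeasurable.prodMk aemeasurable_id)
  have hae : ∀ᵐ s ∂σ, J (u s) s < ∞ := ae_lt_top' hJm hfin
  have hint : ∫ s, l (A (u s)) ∂σ ≤ ∫ s, l k₀ * (α * (J (u s) s).toReal) ∂σ := by
    refine integral_mono_ae ((l.comp A).integrable_comp hu)
      (((integrable_toReal_of_lintegral_ne_top hJm hfin).const_mul α).const_mul _) ?_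
    filter_upwards [hae] with s hs
    exact hJ.apply_le_of_unitBall hα (l.comp A) (fun v hv => hmax (hsub s v hv)) hs.ne
  rw [integral_const_mul, integral_const_mul, integral_toReal hJm hae] at hint
  have hcomm : ∫ s, l (A (u s)) ∂σ = l (A (∫ s, u s ∂σ)) :=
    (l.comp A).integral_comp_comm hu
  rw [hcomm, ← hr] at hint
  linarith

/-- The measure `σ*` makes `u(t) = w_t / ‖w_t‖` admissible, where `w_t` is the sum of the `c_j v_j`
with `s_j = t`; its cost is at most the total weight. -/
theorem IsAdmissible.infConv_sum_dirac_le [CompleteSpace X] [DecidableEq T]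
    [MeasurableSingletonClass T]
    (hJ : IsAdmissible e J) {α : ℝ} {M : ℕ} {c : Fin M → ℝ} (hc : ∀ i, 0 ≤ c i)
    (s : Fin M → T) (v : Fin M → X) (hv : ∀ i, v i ∈ unitBall J α (s i)) :
    ENNReal.ofReal α * infConv J (∑ i, c i • v i)
      (∑ t ∈ Finset.univ.image s,
        ENNReal.ofReal ‖∑ j with s j = t, c j • v j‖ • Measure.dirac t) ≤
      ENNReal.ofReal (∑ i, c i) := by
  set w : T → X := fun t => ∑ j with s j = t, c j • v j with hw
  -- With `0⁻¹ = 0` this holds also where `w t = 0`, so cancellation in `w t` does no harm.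
  have hwn : ∀ t, ‖w t‖ • ‖w t‖⁻¹ • w t = w t := by
    intro t
    rcases eq_or_ne (w t) 0 with h | h
    · simp [h]
    · rw [smul_smul, mul_inv_cancel₀ (norm_ne_zero_iff.2 h), one_smul]
  have hui : ∀ t ∈ Finset.univ.image s, Integrable (fun t => ‖w t‖⁻¹ • w t)
      (ENNReal.ofReal ‖w t‖ • Measure.dirac t) := fun t _ =>
    (integrable_dirac (by simp)).smul_measure ENNReal.ofReal_ne_top
  have hle : infConv J (∑ i, c i • v i)
      (∑ t ∈ Finset.univ.image s, ENNReal.ofReal ‖w t‖ • Measure.dirac t) ≤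
      ∑ i, ENNReal.ofReal (c i) * J (v i) (s i) := by
    refine (iInf₂_le_of_le (fun t => ‖w t‖⁻¹ • w t) (integrable_finsetSum_measure.2 hui)
      (iInf_le _ ?_)).trans ?_
    · rw [integral_finsetSum_measure hui]
      simp only [integral_smul_measure, integral_dirac, ENNReal.toReal_ofReal (norm_nonneg _), hwn]
      exact Finset.sum_fiberwise_of_maps_to
        (fun i _ => Finset.mem_image_of_mem s (Finset.mem_univ i)) _
    · rw [lintegral_finsetSum_measure]
      simp only [lintegral_smul_measure, lintegral_dirac, smul_eq_mul]
      rw [← Finset.sum_fiberwise_of_maps_to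
        (fun i _ => Finset.mem_image_of_mem s (Finset.mem_univ i))]
      refine Finset.sum_le_sum fun t _ => ?_
      rw [← hJ.apply_smul (norm_nonneg _), hwn]
      refine (hJ.apply_sum_smul_le _ (fun i _ => hc i) v t).trans (le_of_eq ?_)
      refine Finset.sum_congr rfl fun i hi => ?_
      rw [(Finset.mem_filter.1 hi).2]
  calc _ ≤ ENNReal.ofReal α * ∑ i, ENNReal.ofReal (c i) * J (v i) (s i) := by gcongr
    _ = ∑ i, ENNReal.ofReal (c i) * (ENNReal.ofReal α * J (v i) (s i)) := by
      rw [Finset.mul_sum]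
      exact Finset.sum_congr rfl fun i _ => by ring
    _ ≤ ∑ i, ENNReal.ofReal (c i) * 1 := by
      gcongr with i
      exact hv i
    _ = _ := by
      simp only [mul_one]
      rw [ENNReal.ofReal_sum_of_nonneg fun i _ => hc i]

end

/-! ### The reduced problem and sparse minimizers -/

/-- The finite-dimensional problem to which the minimization reduces has a solution: values of `t`
above `½ ‖f‖²` are beaten by `t = 0`. -/
theorem exists_forall_half_sq_add_le {Y : Type*} [NormedAddCommGroup Y] [NormedSpace ℝ Y]
    {K : Set Y} (hK : IsCompact K) (hne : K.Nonempty) (f : Y) :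
    ∃ k ∈ K, ∃ t : ℝ, 0 ≤ t ∧ ∀ k' ∈ K, ∀ t' : ℝ, 0 ≤ t' →
      1 / 2 * ‖t • k - f‖ ^ 2 + t ≤ 1 / 2 * ‖t' • k' - f‖ ^ 2 + t' := by
  have hb : 0 ≤ 1 / 2 * ‖f‖ ^ 2 := by positivity
  obtain ⟨⟨k, t⟩, ⟨hk, ht⟩, hmin⟩ := (hK.prod (isCompact_Icc (a := (0 : ℝ))
    (b := 1 / 2 * ‖f‖ ^ 2))).exists_isMinOn (hne.prod ⟨0, le_rfl, hb⟩)
    (f := fun q : Y × ℝ => 1 / 2 * ‖q.2 • q.1 - f‖ ^ 2 + q.2) (by fun_prop)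
  refine ⟨k, hk, t, ht.1, fun k' hk' t' ht' => ?_⟩
  rcases le_total t' (1 / 2 * ‖f‖ ^ 2) with h | h
  · exact hmin (show (k', t') ∈ _ from ⟨hk', ht', h⟩)
  · have h0 : 1 / 2 * ‖t • k - f‖ ^ 2 + t ≤ 1 / 2 * ‖(0 : ℝ) • k - f‖ ^ 2 + 0 :=
      hmin (show (k, (0 : ℝ)) ∈ _ from ⟨hk, le_rfl, hb⟩)
    rw [zero_smul, zero_sub, norm_neg] at h0
    have : 0 ≤ 1 / 2 * ‖t' • k' - f‖ ^ 2 := by positivity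
    linarith

variable {X P T Y : Type*}
    [NormedAddCommGroup X] [NormedSpace ℝ X] [MeasurableSpace X]
    [NormedAddCommGroup P] [NormedSpace ℝ P] [TopologicalSpace.SeparableSpace P]
    [TopologicalSpace T] [MeasurableSpace T] [CompactSpace T] [TopologicalSpace.MetrizableSpace T]
    [NormedAddCommGroup Y] [InnerProductSpace ℝ Y] [FiniteDimensional ℝ Y]
    {e : X ≃ₗᵢ[ℝ] StrongDual ℝ P} {J : X → T → ℝ≥0∞}

/-- Every point of `t K`, where `K` is the convex hull of the images of the unit balls, is a
combination of linearly independent images of extremal points with total weight at most `t`. -/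
theorem IsAdmissible.exists_sparse_representation (hJ : IsAdmissible e J) {α : ℝ} (hα : 0 < α)
    (A : X →L[ℝ] Y)
    (hA : ∃ Apre : Y →L[ℝ] P, ∀ (x : X) (y : Y), inner ℝ (A x) y = e x (Apre y))
    {k : Y} (hk : k ∈ convexHull ℝ (A '' ⋃ s, unitBall J α s)) {t : ℝ} (ht : 0 ≤ t) :
    ∃ (M : ℕ) (c : Fin M → ℝ) (s : Fin M → T) (v : Fin M → X), (∀ i, 0 < c i) ∧
      (∀ i, v i ∈ (unitBall J α (s i)).extremePoints ℝ) ∧ LinearIndependent ℝ (fun i => A (v i)) ∧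
      ∑ i, c i • A (v i) = t • k ∧ ∑ i, c i ≤ t := by
  set D := A '' ⋃ s, unitBall J α s with hD
  have hDc : IsCompact D := hJ.isCompact_image_iUnion_unitBall hα A hA
  have hk' := subset_convexHull_extremePoints (isCompact_convexHull hDc) (convex_convexHull ℝ D) hk
  obtain ⟨ι, _, z, w, hz, -, hw, hw1, hwk⟩ := eq_pos_convex_span_of_mem_convexHull hk'
  have hlift : ∀ i, ∃ (s : T) (v : X), v ∈ (unitBall J α s).extremePoints ℝ ∧ A v = z i := by
    intro i
    have hzi : z i ∈ (convexHull ℝ D).extremePoints ℝ := hz ⟨i, rfl⟩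
    obtain ⟨v, hv, hvz⟩ := extremePoints_convexHull_subset hzi
    obtain ⟨s, hs⟩ := Set.mem_iUnion.1 hv
    have hsub : A '' unitBall J α s ⊆ convexHull ℝ D :=
      (Set.image_mono (Set.subset_iUnion _ s)).trans (subset_convexHull ℝ D)
    exact ⟨s, hJ.exists_mem_extremePoints_unitBall hα A hA
      (inter_extremePoints_subset_extremePoints_of_subset hsub ⟨⟨v, hs, hvz⟩, hzi⟩)⟩
  choose s v hv hvz using hlift
  obtain ⟨I, -, b, hb, hbz, hbt, hli⟩ := exists_linearIndepOn_sum_smul_eq z Finset.univ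
    (fun i => t * w i) fun i _ => mul_nonneg ht (hw i).le
  let ψ := I.equivFin.symm
  -- Enumerate the remaining indices by `Fin I.card`.
  refine ⟨I.card, fun i => b (ψ i), fun i => s (ψ i), fun i => v (ψ i), fun i => hb _ (ψ i).2,
    fun i => hv _, ?_, ?_, ?_⟩
  · simp only [hvz]
    exact LinearIndependent.comp hli ψ ψ.injective
  · simp only [hvz]
    rw [ψ.sum_comp fun i : I => b i • z i, Finset.sum_coe_sort I fun i => b i • z i, hbz, ← hwk,
      Finset.smul_sum]
    simp only [mul_smul]
  · rw [ψ.sum_comp fun i : I => b i, Finset.sum_coe_sort I b]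
    refine hbt.trans (le_of_eq ?_)
    rw [← Finset.mul_sum, hw1, mul_one]

end InfConv

open Classical in
theorem mainTheorem2 {X P Y : Type*}
    [NormedAddCommGroup X] [NormedSpace ℝ X] [CompleteSpace X]
    [TopologicalSpace.SeparableSpace X] [MeasurableSpace X] [BorelSpace X]
    [NormedAddCommGroup P] [NormedSpace ℝ P] [CompleteSpace P]
    (e : X ≃ₗᵢ[ℝ] StrongDual ℝ P)
    [NormedAddCommGroup Y] [InnerProductSpace ℝ Y] [FiniteDimensional ℝ Y]
    (Q : ℕ) (hQ : Module.finrank ℝ Y = Q)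
    (A : X →L[ℝ] Y)
    (hA : ∃ Apre : Y →L[ℝ] P, ∀ (x : X) (y : Y), inner ℝ (A x) y = e x (Apre y))
    (d : ℕ) (S : Set (EuclideanSpace ℝ (Fin d))) (hS : IsCompact S) (hSne : S.Nonempty)
    (J : X → S → ℝ≥0∞) (hJ : InfConv.IsAdmissible e J)
    (f : Y) (α : ℝ) (hα : 0 < α)
    (hsym : ∀ (c : ℝ) (v : X) (s : S), J (c • v) s = ENNReal.ofReal |c| * J v s)
    (hconi : (PointedCone.hull ℝ (A '' ⋃ s : S, InfConv.dom J s) : Set Y) = Set.univ) :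
    ∃ (vstar : X) (σstar : FiniteMeasure S),
      IsMinOn (InfConv.tikhonov J A f α) Set.univ (vstar, σstar) ∧
      ∃ (M : ℕ) (c : Fin M → ℝ) (s : Fin M → S) (v : Fin M → X),
        M ≤ Q ∧ (∀ i, 0 < c i) ∧
        (∀ i, v i ∈ Set.extremePoints ℝ (InfConv.unitBall J α (s i)) \ {0}) ∧
        vstar = ∑ i, c i • v i ∧
        (σstar : Measure S) =
          ∑ t ∈ Finset.univ.image s,
            ENNReal.ofReal ‖∑ j with s j = t, c j • v j‖ • Measure.dirac t := by
  have : CompactSpace S := isCompact_iff_compactSpace.1 hS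
  have : Nonempty S := hSne.to_subtype
  have : TopologicalSpace.SeparableSpace (StrongDual ℝ P) :=
    e.surjective.denseRange.separableSpace e.continuous
  have : TopologicalSpace.SeparableSpace P := InfConv.separableSpace_of_strongDual
  set K := convexHull ℝ (A '' ⋃ s, InfConv.unitBall J α s) with hKdef
  have hK : IsCompact K :=
    InfConv.isCompact_convexHull (hJ.isCompact_image_iUnion_unitBall hα A hA)
  have h0K : (0 : Y) ∈ K := subset_convexHull ℝ _
    ⟨0, Set.mem_iUnion.2 ⟨Classical.arbitrary S, hJ.zero_mem_unitBall α _⟩, map_zero A⟩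
  obtain ⟨k, hk, t, ht, hmin⟩ := InfConv.exists_forall_half_sq_add_le hK ⟨0, h0K⟩ f
  obtain ⟨M, c, s, v, hc, hv, hli, hsum, hct⟩ := hJ.exists_sparse_representation hα A hA hk ht
  obtain ⟨σ, hσ⟩ : ∃ σ : FiniteMeasure S, (σ : Measure S) = ∑ t ∈ Finset.univ.image s,
      ENNReal.ofReal ‖∑ j with s j = t, c j • v j‖ • Measure.dirac t := by
    refine ⟨⟨∑ t ∈ Finset.univ.image s,
      ENNReal.ofReal ‖∑ j with s j = t, c j • v j‖ • Measure.dirac t, ⟨?_⟩⟩, rfl⟩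
    simp only [Measure.coe_finsetSum, Finset.sum_apply, Measure.smul_apply, smul_eq_mul,
      measure_univ, mul_one]
    exact ENNReal.sum_lt_top.2 fun _ _ => ENNReal.ofReal_lt_top
  have hAv : A (∑ i, c i • v i) = t • k := by simpa using hsum
  have hupper : InfConv.tikhonov J A f α (∑ i, c i • v i, σ) ≤
      ENNReal.ofReal (1 / 2 * ‖t • k - f‖ ^ 2 + t) := by
    rw [ENNReal.ofReal_add (by positivity) ht]
    refine add_le_add (le_of_eq (by rw [← hAv])) ?_
    rw [hσ]
    refine le_trans ?_ (ENNReal.ofReal_le_ofReal hct)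
    exact hJ.infConv_sum_dirac_le (fun i => (hc i).le) s v fun i => extremePoints_subset (hv i)
  refine ⟨∑ i, c i • v i, σ, ?_, M, c, s, v, ?_, hc, fun i => ⟨hv i, ?_⟩, rfl, hσ⟩
  · rintro ⟨v', σ'⟩ -
    have hα0 : ENNReal.ofReal α ≠ 0 := by simpa using hα
    refine hupper.trans ?_
    simp only [InfConv.tikhonov, InfConv.infConv,
      ENNReal.mul_iInf_of_ne hα0 ENNReal.ofReal_ne_top, ENNReal.add_iInf]
    refine le_iInf fun u => le_iInf fun hu => le_iInf fun huv => ?_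
    by_cases hfin : ∫⁻ s, J (u s) s ∂(σ' : Measure S) = ∞
    · simp [hfin, ENNReal.mul_top hα0]
    obtain ⟨k', hk', hk'eq⟩ := hJ.exists_map_integral_eq_smul hα A hK hu hfin
    have hr : 0 ≤ α * (∫⁻ s, J (u s) s ∂(σ' : Measure S)).toReal := by positivity
    rw [← ENNReal.ofReal_toReal hfin]
    rw [← ENNReal.ofReal_mul hα.le, ← ENNReal.ofReal_add (by positivity) hr]
    refine ENNReal.ofReal_le_ofReal ?_
    rw [← huv, hk'eq]
    exact hmin k' hk' _ hr
  · have := hli.fintype_card_le_finrank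
    simpa [hQ] using this
  · intro h0
    exact hli.ne_zero i (by rw [Set.mem_singleton_iff.1 h0, map_zero])
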